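/- Let $\mathcal S,\mathcal A$ be finite sets, $s_1\in\mathcal S$, $T\ge 1$, and let $\mathcal M=(\mathcal M_i)_i$ be a finite family of MDPs $\mathcal M_i=(\mathcal S,\mathcal A,p_i,r_i,s_1,T)$ with transition probabilities $p_i(\cdot\mid s,a)$, deterministic rewards $r_i(s,a)\in[0,1]$, common initial state $s_1$ and common horizon $T$. Policies are non-stationary randomized Markov policies $\pi=(\pi_t)_{t\in[T]}\in\Pi$, and $V_i(\pi)=\mathbb E_{\pi,\mathcal M_i}\big[\sum_{t=1}^T r_i(s_t,a_t)\big]$ is the value of $\pi$ from $s_1$; a policy is optimal for $\mathcal M_i$ if it lies in $\Pi^*_i=\arg\max_{\pi\in\Pi}V_i(\pi)$. A best-policy-identification algorithm knows $\mathcal M$ and interacts in episodes of length $T$ with an unknown $\mathcal M_i$. Each of its three rules is a function of the observations $(s_t,a_t,r_t)_{t\in[T]}$ of the episodes completed so far: a sampling rule chooses the policy of the next episode, a stopping rule decides whether to stop, and a decision rule gives the output policy $\hat\pi_\tau$. The sample complexity is $\mathbb E_{\mathcal M_i}[\tau]\in[0,\infty]$, where $\tau$ is $T$ times the number of episodes run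 ($\tau=\infty$ if the algorithm never stops). For $\delta\in(0,1)$ the algorithm is $\delta$-PC if for every $\mathcal M_j\in\mathcal M$, with probability at least $1-\delta$ under $\mathcal M_j$, it stops and $\hat\pi_\tau\in\Pi^*_j$. Let $\mathcal M_{-i}$ be the set of alternatives to $\mathcal M_i$, i.e. of the $\mathcal M_j\in\mathcal M$ that have no optimal policy in common with $\mathcal M_i$: $\Pi^*_i\cap\Pi^*_j=\emptyset$. (If all the MDPs in $\mathcal M$ have unique and pairwise different optimal policies, then $\mathcal M_{-i}=\mathcal M\setminus\{\mathcal M_i\}$.) Let $\Sigma(\mathcal M_i)$ be the set of $\omega\in\mathcal P(\mathcal S\times\mathcal A)$ of the form $\omega(s,a)=\frac1T\sum_{t\in[T]}\omega(s,a,t)$ with $\omega(\cdot,\cdot,t)\in\mathcal P(\mathcal S\times\mathcal A)$ for all $t$, $\sum_a\omega(s_1,a,1)=1$, and $\sum_a\omega(s,a,t)=\sum_{s',a'}p_i(s\mid s',a')\,\omega(s',a',t-1)$ for all $s$ and all $2\le t\le T$. Let $\mathrm{KL}_{\mathcal M_i|\mathcal M_j}(s,a)\in[0,\infty]$ be the symmetrized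 Kullback–Leibler divergence $\mathrm{KL}(P,Q)+\mathrm{KL}(Q,P)$ between what the pair $(s,a)$ produces (next state and reward) in $\mathcal M_i$ and in $\mathcal M_j$; that is, the symmetrized divergence between $p_i(\cdot\mid s,a)$ and $p_j(\cdot\mid s,a)$ if $r_i(s,a)=r_j(s,a)$, and $\infty$ otherwise. Then for every $\delta\in(0,1)$, every $\delta$-PC algorithm, and every $\mathcal M_i\in\mathcal M$, $$\mathbb E_{\mathcal M_i}[\tau]\;\ge\;T^*(\mathcal M_i)^{-1}\,\max\Big\{0,\log\frac1{2.4\,\delta}\Big\},\qquad T^*(\mathcal M_i)=\sup_{\omega\in\Sigma(\mathcal M_i)}\ \inf_{\mathcal M_j\in\mathcal M_{-i}}\ \sum_{s,a}\omega(s,a)\,\mathrm{KL}_{\mathcal M_i|\mathcal M_j}(s,a),$$ in $[0,\infty]$, with $0\cdot\infty=0$, $0^{-1}=\infty$, $\infty^{-1}=0$ and $\inf\emptyset=\infty$. -/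

import Mathlib

open MeasureTheory ProbabilityTheory InformationTheory
open scoped ENNReal

noncomputable section

namespace BPI

/-- A time-homogeneous tabular Markov decision process with states `S` and actions `A`. The initial
state and the horizon are kept as separate parameters, because all tasks share them. -/
structure MDP (S A : Type*) where
  /-- transition probabilities `p(· | s, a)` -/
  p : S → A → PMF S
  /-- the (deterministic) reward collected when taking action `a` in state `s` -/
  r : S → A → ℝ
  r_mem : ∀ s a, r s a ∈ Set.Icc (0 : ℝ) 1

/-- Non-stationary, randomized Markov policies `π = (π_t)` over `T` steps. -/
abbrev Policy (S A : Type*) (T : ℕ) := Fin T → S → PMF A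

/-- State-action trajectories `(s_t, a_t)` of one episode of `T` steps. -/
abbrev Episode (S A : Type*) (T : ℕ) := Fin T → S × A

/-- What the learner sees of one episode: `(s_t, a_t, r_t)` for the `T` steps. -/
abbrev Obs (S A : Type*) (T : ℕ) := Fin T → S × A × ℝ

variable {S A : Type*}

namespace MDP

/-- The law of an `n`-step episode from state `s` under the policy `π`: draw
`a ∼ π_1(· | s)` and `s' ∼ p(· | s, a)`, and run the rest of the policy from `s'`. -/
def episodeLaw (M : MDP S A) : (n : ℕ) → Policy S A n → S → PMF (Episode S A n)
  | 0, _, _ => PMF.pure Fin.elim0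
  | n + 1, π, s =>
      (π 0 s).bind fun a =>
        (M.p s a).bind fun s' =>
          (episodeLaw M n (Fin.tail π) s').map fun e => (Fin.cons (s, a) e : Episode S A (n + 1))

/-- The value `V(π)`: the expected total reward of an episode that starts in `s₁`. -/
def value [Fintype S] [Fintype A] {T : ℕ} (M : MDP S A) (s₁ : S) (π : Policy S A T) : ℝ :=
  ∑ e : Episode S A T, (M.episodeLaw T π s₁ e).toReal * ∑ t, M.r (e t).1 (e t).2

/-- The optimal policies `argmax_π V(π)`. -/
def optimalPolicies [Fintype S] [Fintype A] (M : MDP S A) (s₁ : S) (T : ℕ) :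
    Set (Policy S A T) :=
  {π | ∀ π' : Policy S A T, M.value s₁ π' ≤ M.value s₁ π}

/-- The observation that the episode `e` produces in `M`. -/
def observe {T : ℕ} (M : MDP S A) (e : Episode S A T) : Obs S A T :=
  fun t => ((e t).1, (e t).2, M.r (e t).1 (e t).2)

/-- The list of observations, in chronological order, of `h` consecutive episodes. -/
def history {T : ℕ} (M : MDP S A) {h : ℕ} (e : Fin h → Episode S A T) : List (Obs S A T) :=
  List.ofFn fun k => M.observe (e k)

/-- The set `Σ(M)` of allocation vectors: the time averages `ω` of flow-feasible step-wise
state-action distributions `w_1, …, w_T` with initial state `s₁`. -/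
def allocations [Fintype S] [Fintype A] (M : MDP S A) (s₁ : S) (T : ℕ) : Set (PMF (S × A)) :=
  {ω | ∃ w : Fin T → PMF (S × A),
    (∀ x, ω x = (T : ℝ≥0∞)⁻¹ * ∑ t, w t x) ∧
    (∀ t : Fin T, t.val = 0 → ∑ a, w t (s₁, a) = 1) ∧
    (∀ t t' : Fin T, t'.val = t.val + 1 →
      ∀ s, ∑ a, w t' (s, a) = ∑ s', ∑ a', M.p s' a' s * w t (s', a'))}

end MDP

/-- The symmetrized Kullback-Leibler divergence (`∞` when the two measures are not mutually
absolutely continuous). -/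
def symKL {X : Type*} [MeasurableSpace X] (μ ν : Measure X) : ℝ≥0∞ :=
  klDiv μ ν + klDiv ν μ

/-- The symmetrized divergence between the outcomes (next state, reward) of the pair `(s, a)` in two
MDPs. Rewards are deterministic, so the reward term is `0` if the two rewards agree, and `∞`
otherwise. -/
def divergence [MeasurableSpace S] (M M' : MDP S A) (s : S) (a : A) : ℝ≥0∞ :=
  symKL (M.p s a).toMeasure (M'.p s a).toMeasure +
    symKL (Measure.dirac (M.r s a)) (Measure.dirac (M'.r s a))

/-- The alternatives to the task `i` in the family `M`: the tasks that have no optimal policy in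
common with it. -/
def alternatives [Fintype S] [Fintype A] {ι : Type*} (M : ι → MDP S A) (s₁ : S) (T : ℕ) (i : ι) :
    Set ι :=
  {j | Disjoint ((M i).optimalPolicies s₁ T) ((M j).optimalPolicies s₁ T)}

/-- `T^*(M_i)`: the supremum over allocations of the smallest weighted divergence to an
alternative. -/
def Tstar [Fintype S] [Fintype A] [MeasurableSpace S] {ι : Type*} (M : ι → MDP S A) (s₁ : S)
    (T : ℕ) (i : ι) : ℝ≥0∞ :=
  ⨆ ω ∈ (M i).allocations s₁ T, ⨅ j ∈ alternatives M s₁ T i,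
    ∑ s, ∑ a, ω (s, a) * divergence (M i) (M j) s a

/-- A best policy identification algorithm. All three rules see the observations of the
episodes completed so far. -/
structure Algorithm (S A : Type*) (T : ℕ) where
  /-- sampling rule: the policy to run in the next episode -/
  sampling : List (Obs S A T) → Policy S A T
  /-- stopping rule: whether to stop after the completed episodes -/
  halt : List (Obs S A T) → Prop
  /-- decision rule: the policy that is output when the sampling stops -/
  decision : List (Obs S A T) → Policy S A T

namespace Algorithm

variable {T : ℕ} (alg : Algorithm S A T) (M : MDP S A) (s₁ : S)

section law

variable [Fintype S] [Fintype A] [MeasurableSpace S] [DiscreteMeasurableSpace S]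
  [MeasurableSpace A] [DiscreteMeasurableSpace A]

/-- The conditional law of the next episode, given the episodes `0, …, n`. -/
def nextEpisode (n : ℕ) :
    Kernel (Π _ : Finset.Iic n, Episode S A T) (Episode S A T) :=
  Kernel.ofFunOfCountable fun e =>
    (M.episodeLaw T (alg.sampling (M.history (h := n + 1) fun k =>
      e ⟨k.val, Finset.mem_Iic.mpr (Nat.lt_succ_iff.mp k.isLt)⟩)) s₁).toMeasure

instance (n : ℕ) : IsMarkovKernel (alg.nextEpisode M s₁ n) :=
  ⟨fun _ => by
    unfold nextEpisode
    exact PMF.toMeasure.isProbabilityMeasure _⟩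

/-- The law of the infinite sequence of episodes generated by the sampling rule in the task `M`. -/
def law : Measure (ℕ → Episode S A T) :=
  Kernel.trajMeasure (X := fun _ => Episode S A T)
    (M.episodeLaw T (alg.sampling []) s₁).toMeasure (alg.nextEpisode M s₁)

end law

/-- The observations of the first `h` episodes of the sequence `e`. -/
def pastObs (e : ℕ → Episode S A T) (h : ℕ) : List (Obs S A T) :=
  M.history fun k : Fin h => e k

/-- The algorithm stops after exactly `h` episodes. -/
def StopsAt (e : ℕ → Episode S A T) (h : ℕ) : Prop :=
  alg.halt (pastObs M e h) ∧ ∀ h' < h, ¬ alg.halt (pastObs M e h')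

/-- The number `τ` of samples: `T` times the number of episodes at the first time that the stopping
rule holds, and `∞` if this never happens. -/
def samples (e : ℕ → Episode S A T) : ℕ∞ :=
  ⨅ h : ℕ, ⨅ _ : alg.StopsAt M e h, ((T * h : ℕ) : ℕ∞)

variable [Fintype S] [Fintype A] [MeasurableSpace S] [DiscreteMeasurableSpace S]
  [MeasurableSpace A] [DiscreteMeasurableSpace A]

/-- The sample complexity `E[τ]` in the task `M`. -/
def sampleComplexity : ℝ≥0∞ :=
  ∫⁻ e, (alg.samples M e : ℝ≥0∞) ∂(alg.law M s₁)

/-- `δ`-PC on the family `M`: in each of the tasks, with probability at least `1 - δ`, the algorithm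
stops and outputs an optimal policy of that task. -/
def IsPC {ι : Type*} (M : ι → MDP S A) (s₁ : S) (δ : ℝ) : Prop :=
  ∀ j, ENNReal.ofReal (1 - δ) ≤ alg.law (M j) s₁
    {e | ∃ h, alg.StopsAt (M j) e h ∧
      alg.decision (pastObs (M j) e h) ∈ (M j).optimalPolicies s₁ T}

end Algorithm

end BPI

end

/-!
The bound rests on a change of measure between the task `i` and an alternative `j`, carried out by
recursion over the observations, with finite sums only. The elementary step is the Donsker-Varadhan
inequality `E_P[log Z] ≤ KL(P, Q) + log E_Q[Z]`, for `Z ≥ 1` (`expect_elog_le`). Applied to one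
transition at a time, it accumulates along an episode the divergences of the visited pairs
(`expect_elog_episode_le`). If the rewards of a visited pair differ, its divergence is infinite and
there is nothing to prove, so the observations may be identified otherwise. Applied to one episode
at a time, with the test function `1 + b · 1_E` where `E` is the event that the algorithm stops
within `n` episodes and outputs an optimal policy of the task `i`, it gives
`log(1 + b) P_i(E) ≤ (divergence collected in task i) + log(1 + b P_j(E))`
(`Algorithm.elog_mul_successProb_le`).

The divergence that is collected in task `i` is the sum of the divergences of all pairs, weighted by
their expected visit counts up to the stopping time (capped at `n`). Each policy satisfies the flow
equations, hence so do these counts, and dividing by the expected number of samples gives an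
allocation `ω` of the task `i` (`Algorithm.exists_allocation`). It does not depend on `j`, so taking
the infimum over the alternatives bounds the collected divergence by `E[τ]` times `Tstar`.

As `n → ∞`, correctness of the algorithm gives `P_i(E) ≥ 1 - δ` in the limit, while `P_j(E) ≤ δ`
because no optimal policy of task `i` is optimal in task `j`. With `1 + b = ((1 - δ)/δ)²` the
inequality becomes `(1 - 2δ) log((1 - δ)/δ) ≤ E[τ] Tstar`, and the left side is at least
`log(1/(2.4δ))` (`log_inv_le_binary_kl`).

The recursion is tied to the law of the infinite sequence of episodes in
`Algorithm.lintegral_pathTotal`, through the tower property `Algorithm.lintegral_next`. Capping at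
`n` episodes keeps all quantities finite, so that no integrability of `τ` is needed.
-/

noncomputable section

namespace BPI

/-! ### Expectations and the Donsker-Varadhan inequality -/

/-- The expectation of a `[0, ∞]`-valued function under a probability mass function. -/
def expect {X : Type*} (p : PMF X) (f : X → ℝ≥0∞) : ℝ≥0∞ := ∑' x, p x * f x

section expect

variable {X Y : Type*}

lemma expect_pure (x : X) (f : X → ℝ≥0∞) : expect (PMF.pure x) f = f x := by
  classical
  unfold expect
  rw [tsum_eq_single x]
  · simp
  · intro y hy
    simp [PMF.pure_apply, hy]

lemma expect_bind (p : PMF X) (k : X → PMF Y) (f : Y → ℝ≥0∞) :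
    expect (p.bind k) f = expect p fun x => expect (k x) f := by
  unfold expect
  simp only [PMF.bind_apply, ← ENNReal.tsum_mul_right, ← ENNReal.tsum_mul_left]
  rw [ENNReal.tsum_comm]
  simp only [mul_assoc]

lemma expect_map (p : PMF X) (g : X → Y) (f : Y → ℝ≥0∞) :
    expect (p.map g) f = expect p fun x => f (g x) := by
  rw [← PMF.bind_pure_comp, expect_bind]
  simp [expect_pure]

lemma expect_mono (p : PMF X) {f g : X → ℝ≥0∞} (h : ∀ x, f x ≤ g x) : expect p f ≤ expect p g :=
  ENNReal.tsum_le_tsum fun x => by gcongr; exact h x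

lemma expect_add (p : PMF X) (f g : X → ℝ≥0∞) :
    expect p (fun x => f x + g x) = expect p f + expect p g := by
  simp only [expect, mul_add, ENNReal.tsum_add]

lemma expect_const (p : PMF X) (c : ℝ≥0∞) : expect p (fun _ => c) = c := by
  simp [expect, ENNReal.tsum_mul_right]

lemma expect_const_mul (p : PMF X) (c : ℝ≥0∞) (f : X → ℝ≥0∞) :
    expect p (fun x => c * f x) = c * expect p f := by
  simp only [expect, ← ENNReal.tsum_mul_left]
  congr 1 with x
  ring

lemma expect_sum {ι : Type*} (p : PMF X) (s : Finset ι) (f : ι → X → ℝ≥0∞) :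
    expect p (fun x => ∑ i ∈ s, f i x) = ∑ i ∈ s, expect p (f i) := by
  classical
  induction s using Finset.induction_on with
  | empty => simpa using expect_const p 0
  | insert i s hi ih => simp only [Finset.sum_insert hi, expect_add, ih]

lemma one_le_expect (p : PMF X) {Z : X → ℝ≥0∞} (h1 : ∀ x, 1 ≤ Z x) : 1 ≤ expect p Z := by
  simpa [expect_const] using expect_mono p h1

lemma expect_ne_top [Fintype X] (p : PMF X) {Z : X → ℝ≥0∞} (hZ : ∀ x, Z x ≠ ∞) :
    expect p Z ≠ ∞ := by
  rw [expect, tsum_fintype]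
  exact ENNReal.sum_ne_top.mpr fun x _ => ENNReal.mul_ne_top (p.apply_ne_top x) (hZ x)

lemma lintegral_toMeasure_eq_expect [Fintype X] [MeasurableSpace X] [DiscreteMeasurableSpace X]
    (p : PMF X) (f : X → ℝ≥0∞) : ∫⁻ x, f x ∂p.toMeasure = expect p f := by
  rw [lintegral_fintype, expect, tsum_fintype]
  refine Finset.sum_congr rfl fun x _ => ?_
  rw [PMF.toMeasure_apply_singleton _ _ (MeasurableSet.singleton x), mul_comm]

end expect

/-- The positive part of the real logarithm, as a function on `[0, ∞]`. It is only used at finite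
arguments `z ≥ 1` (at `z = ∞` it has the junk value `0`). -/
def elog (z : ℝ≥0∞) : ℝ≥0∞ := ENNReal.ofReal (Real.log z.toReal)

lemma elog_mono {y z : ℝ≥0∞} (hy : 1 ≤ y) (hyz : y ≤ z) (hz : z ≠ ∞) : elog y ≤ elog z := by
  have h : y.toReal ≤ z.toReal := ENNReal.toReal_mono hz hyz
  have h1 : (1 : ℝ) ≤ y.toReal := by
    simpa using ENNReal.toReal_mono (ne_top_of_le_ne_top hz hyz) hy
  exact ENNReal.ofReal_le_ofReal (Real.log_le_log (by linarith) h)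

section donskerVaradhan

variable {X : Type*}

/-- The Donsker-Varadhan variational inequality, for bounded test functions `f`. It is Gibbs'
inequality for the first measure and the exponential tilting of the second one by `f`. -/
lemma integral_le_klDiv_add_log_integral_exp [MeasurableSpace X] {μ ν : Measure X}
    [IsProbabilityMeasure μ] [IsProbabilityMeasure ν] {f : X → ℝ} (hfμ : Integrable f μ)
    (hfν : Integrable (fun x => Real.exp (f x)) ν) (h : klDiv μ ν ≠ ∞) :
    ∫ x, f x ∂μ ≤ (klDiv μ ν).toReal + Real.log (∫ x, Real.exp (f x) ∂ν) := by
  obtain ⟨hac, hint⟩ := klDiv_ne_top_iff.mp h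
  have := isProbabilityMeasure_tilted hfν
  have hG := integral_llr_add_sub_measure_univ_nonneg (ν := ν.tilted f)
    (hac.trans (absolutelyContinuous_tilted hfν))
    (integrable_llr_tilted_right hac hfμ hint hfν)
  rw [integral_llr_tilted_right hac hfμ hfν hint] at hG
  rw [toReal_klDiv_of_measure_eq hac (by simp)]
  simp only [probReal_univ] at hG
  linarith

variable [Fintype X] [MeasurableSpace X] [DiscreteMeasurableSpace X]

/-- The Donsker-Varadhan inequality in multiplicative form, for test functions with values in
`[1, ∞)`. -/
lemma expect_elog_le (p q : PMF X) {Z : X → ℝ≥0∞} (h1 : ∀ x, 1 ≤ Z x) (hZ : ∀ x, Z x ≠ ∞) :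
    expect p (fun x => elog (Z x)) ≤
      klDiv p.toMeasure q.toMeasure + elog (expect q Z) := by
  by_cases hkl : klDiv p.toMeasure q.toMeasure = ∞
  · simp [hkl]
  have hpos : ∀ x, 1 ≤ (Z x).toReal := fun x => by
    simpa using ENNReal.toReal_mono (hZ x) (h1 x)
  have key := integral_le_klDiv_add_log_integral_exp (μ := p.toMeasure) (ν := q.toMeasure)
    (f := fun x => Real.log (Z x).toReal) .of_finite .of_finite hkl
  have hexp : ∀ x, Real.exp (Real.log (Z x).toReal) = (Z x).toReal := fun x =>
    Real.exp_log (by linarith [hpos x])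
  simp only [hexp] at key
  have hq : ∫ x, (Z x).toReal ∂q.toMeasure = (expect q Z).toReal := by
    rw [PMF.integral_eq_sum, expect, tsum_fintype, ENNReal.toReal_sum]
    · simp
    · exact fun x _ => ENNReal.mul_ne_top (q.apply_ne_top x) (hZ x)
  have hp : expect p (fun x => elog (Z x)) =
      ENNReal.ofReal (∫ x, Real.log (Z x).toReal ∂p.toMeasure) := by
    rw [PMF.integral_eq_sum, expect, tsum_fintype, ENNReal.ofReal_sum_of_nonneg]
    · refine Finset.sum_congr rfl fun x _ => ?_
      rw [smul_eq_mul, ENNReal.ofReal_mul ENNReal.toReal_nonneg,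
        ENNReal.ofReal_toReal (p.apply_ne_top x), elog]
    · exact fun x _ => mul_nonneg ENNReal.toReal_nonneg (Real.log_nonneg (hpos x))
  rw [hp, elog, ← ENNReal.ofReal_toReal hkl, ← ENNReal.ofReal_add ENNReal.toReal_nonneg, ← hq]
  · exact ENNReal.ofReal_le_ofReal key
  · refine Real.log_nonneg ?_
    simpa using ENNReal.toReal_mono (expect_ne_top q hZ) (one_le_expect q h1)

/-- Jensen's inequality for the logarithm. -/
lemma expect_elog_le_elog_expect (p : PMF X) {Z : X → ℝ≥0∞} (h1 : ∀ x, 1 ≤ Z x)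
    (hZ : ∀ x, Z x ≠ ∞) : expect p (fun x => elog (Z x)) ≤ elog (expect p Z) := by
  simpa [klDiv_self] using expect_elog_le p p h1 hZ

end donskerVaradhan

/-! ### Change of measure within one episode -/

variable {S A : Type*}

namespace MDP

lemma expect_episodeLaw_succ (M : MDP S A) {n : ℕ} (π : Policy S A (n + 1)) (s : S)
    (F : Episode S A (n + 1) → ℝ≥0∞) :
    expect (M.episodeLaw (n + 1) π s) F =
      expect (π 0 s) fun a => expect (M.p s a) fun s' =>
        expect (M.episodeLaw n (Fin.tail π) s') fun e => F (Fin.cons (s, a) e) := by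
  simp only [episodeLaw, expect_bind, expect_map]

lemma observe_cons (M : MDP S A) {n : ℕ} (s : S) (a : A) (e : Episode S A n) :
    M.observe (Fin.cons (s, a) e : Episode S A (n + 1)) =
      (Fin.cons (s, a, M.r s a) (M.observe e) : Obs S A (n + 1)) := by
  funext t
  refine Fin.cases ?_ (fun t => ?_) t <;> simp [observe]

/-- The law of the state-action pair at step `t` of an `n`-step episode that starts in `s` and
follows the policy `π`. -/
def stepLaw (M : MDP S A) : (n : ℕ) → Policy S A n → S → Fin n → PMF (S × A)
  | 0, _, _ => Fin.elim0
  | n + 1, π, s => Fin.cases ((π 0 s).map fun a => (s, a)) fun t =>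
      (π 0 s).bind fun a => (M.p s a).bind fun s' => stepLaw M n (Fin.tail π) s' t

lemma expect_stepLaw_zero (M : MDP S A) {n : ℕ} (π : Policy S A (n + 1)) (s : S)
    (f : S × A → ℝ≥0∞) :
    expect (M.stepLaw (n + 1) π s 0) f = expect (π 0 s) fun a => f (s, a) := by
  simp [stepLaw, expect_map]

lemma expect_stepLaw_succ (M : MDP S A) {n : ℕ} (π : Policy S A (n + 1)) (s : S) (t : Fin n)
    (f : S × A → ℝ≥0∞) :
    expect (M.stepLaw (n + 1) π s t.succ) f = expect (π 0 s) fun a => expect (M.p s a) fun s' =>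
      expect (M.stepLaw n (Fin.tail π) s' t) f := by
  simp [stepLaw, expect_bind]

lemma expect_stepLaw_initial (M : MDP S A) {n : ℕ} (π : Policy S A n) (s : S) (t : Fin n)
    (ht : t.val = 0) (f : S → ℝ≥0∞) :
    expect (M.stepLaw n π s t) (fun x => f x.1) = f s := by
  cases n with
  | zero => exact t.elim0
  | succ n =>
    obtain rfl : t = 0 := Fin.ext ht
    simp only [expect_stepLaw_zero, expect_const]

lemma expect_stepLaw_flow (M : MDP S A) {n : ℕ} (π : Policy S A n) (s : S) (t t' : Fin n)
    (htt' : t'.val = t.val + 1) (f : S → ℝ≥0∞) :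
    expect (M.stepLaw n π s t') (fun x => f x.1) =
      expect (M.stepLaw n π s t) fun x => expect (M.p x.1 x.2) f := by
  induction n generalizing s with
  | zero => exact t.elim0
  | succ n ih =>
    refine Fin.cases (fun h => absurd h (by simp)) (fun u' => ?_) t' htt'
    refine Fin.cases (fun h => ?_) (fun u h => ?_) t
    · rw [expect_stepLaw_zero, expect_stepLaw_succ]
      congr 1 with a
      congr 1 with s'
      exact M.expect_stepLaw_initial _ _ _ (by simpa using h) f
    · rw [expect_stepLaw_succ, expect_stepLaw_succ]
      congr 1 with a
      congr 1 with s'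
      exact ih (Fin.tail π) s' u u' (by simpa using h)

end MDP

lemma klDiv_le_divergence [MeasurableSpace S] (M M' : MDP S A) (s : S) (a : A) :
    klDiv (M.p s a).toMeasure (M'.p s a).toMeasure ≤ divergence M M' s a :=
  le_self_add.trans le_self_add

lemma divergence_eq_top_of_ne [MeasurableSpace S] {M M' : MDP S A} {s : S} {a : A}
    (h : M.r s a ≠ M'.r s a) : divergence M M' s a = ∞ := by
  have hac : ¬ Measure.dirac (M.r s a) ≪ Measure.dirac (M'.r s a) := by
    intro hac
    have h0 := hac (s := {M.r s a}) (by simp [h.symm])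
    simp at h0
  simp [divergence, symKL, klDiv_of_not_ac hac]

/-- Change of measure within one episode: `Z` is a function of what the learner observes, and the
laws of the observations in two tasks differ by at most the divergences that are collected along
the episode in the first task. -/
lemma expect_elog_episode_le [Fintype S] [Fintype A] [MeasurableSpace S]
    [DiscreteMeasurableSpace S] [MeasurableSpace A] [DiscreteMeasurableSpace A] (M M' : MDP S A)
    {n : ℕ} (π : Policy S A n) (s : S) {Z : Obs S A n → ℝ≥0∞} (h1 : ∀ o, 1 ≤ Z o)
    (hZ : ∀ o, Z o ≠ ∞) :
    expect (M.episodeLaw n π s) (fun e => elog (Z (M.observe e))) ≤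
      ∑ t, expect (M.stepLaw n π s t) (fun x => divergence M M' x.1 x.2) +
        elog (expect (M'.episodeLaw n π s) fun e => Z (M'.observe e)) := by
  induction n generalizing s with
  | zero =>
    simp only [MDP.episodeLaw, expect_pure, Finset.univ_eq_empty, Finset.sum_empty, zero_add]
    rw [Subsingleton.elim (M.observe _) (M'.observe _)]
  | succ n ih =>
    simp only [Fin.sum_univ_succ, MDP.expect_stepLaw_zero, MDP.expect_stepLaw_succ,
      MDP.expect_episodeLaw_succ, MDP.observe_cons]
    set C : S → ℝ≥0∞ := fun s' => ∑ t, expect (M.stepLaw n (Fin.tail π) s' t)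
      (fun x => divergence M M' x.1 x.2) with hC
    set W : A → S → ℝ≥0∞ := fun a s' => expect (M'.episodeLaw n (Fin.tail π) s')
      (fun e => Z (Fin.cons (s, a, M'.r s a) (M'.observe e))) with hW
    have hW1 : ∀ a s', 1 ≤ W a s' := fun a s' => one_le_expect _ fun _ => h1 _
    have hWt : ∀ a s', W a s' ≠ ∞ := fun a s' => expect_ne_top _ fun _ => hZ _
    -- one transition, followed by the rest of the episode
    have step : ∀ a, expect (M.p s a) (fun s' => expect (M.episodeLaw n (Fin.tail π) s')
        fun e => elog (Z (Fin.cons (s, a, M.r s a) (M.observe e)))) ≤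
          divergence M M' s a + expect (M.p s a) C + elog (expect (M'.p s a) (W a)) := by
      intro a
      by_cases hr : M.r s a = M'.r s a
      · calc _ ≤ expect (M.p s a) (fun s' => C s' + elog (W a s')) := by
              refine expect_mono _ fun s' => ?_
              rw [hr]
              exact ih (Fin.tail π) s' (Z := fun o => Z (Fin.cons (s, a, M'.r s a) o))
                (fun o => h1 _) (fun o => hZ _)
          _ = expect (M.p s a) C + expect (M.p s a) (fun s' => elog (W a s')) := expect_add _ _ _
          _ ≤ expect (M.p s a) C +
                (divergence M M' s a + elog (expect (M'.p s a) (W a))) := by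
              gcongr
              exact (expect_elog_le _ _ (hW1 a) (hWt a)).trans
                (add_le_add_left (klDiv_le_divergence M M' s a) _)
          _ = _ := by ring
      · simp [divergence_eq_top_of_ne hr]
    calc _ ≤ expect (π 0 s) (fun a =>
            divergence M M' s a + expect (M.p s a) C + elog (expect (M'.p s a) (W a))) :=
          expect_mono _ step
      _ = expect (π 0 s) (fun a => divergence M M' s a) +
            expect (π 0 s) (fun a => expect (M.p s a) C) +
            expect (π 0 s) (fun a => elog (expect (M'.p s a) (W a))) := by
          rw [expect_add, expect_add]
      _ ≤ expect (π 0 s) (fun a => divergence M M' s a) +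
            expect (π 0 s) (fun a => expect (M.p s a) C) +
            elog (expect (π 0 s) fun a => expect (M'.p s a) (W a)) := by
          gcongr
          exact expect_elog_le_elog_expect _ (fun a => one_le_expect _ (hW1 a))
            (fun a => expect_ne_top _ (hWt a))
      _ = _ := by
          simp only [hC, hW, expect_sum]

/-! ### Change of measure for the interaction -/

namespace Algorithm

variable {T : ℕ} (alg : Algorithm S A T) (M : MDP S A) (s₁ : S)

open Classical in
/-- The expected total of a running reward `g` and a terminal reward `q` over at most `n` further
episodes, when the learner has made the observations `l`: each episode that is run earns `g` of the
observations before it, and stopping earns `q`; running out of the `n` episodes earns nothing. -/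
def expectedTotal (g q : List (Obs S A T) → ℝ≥0∞) : ℕ → List (Obs S A T) → ℝ≥0∞
  | 0, l => if alg.halt l then q l else 0
  | n + 1, l => if alg.halt l then q l else
      g l + expect (M.episodeLaw T (alg.sampling l) s₁) fun e =>
        expectedTotal g q n (l ++ [M.observe e])

variable {alg M s₁}

lemma expectedTotal_of_halt {g q : List (Obs S A T) → ℝ≥0∞} {l : List (Obs S A T)}
    (h : alg.halt l) (n : ℕ) : alg.expectedTotal M s₁ g q n l = q l := by
  cases n <;> simp [expectedTotal, h]

lemma expectedTotal_zero {g q : List (Obs S A T) → ℝ≥0∞} {l : List (Obs S A T)}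
    (h : ¬ alg.halt l) : alg.expectedTotal M s₁ g q 0 l = 0 := by
  simp [expectedTotal, h]

lemma expectedTotal_succ {g q : List (Obs S A T) → ℝ≥0∞} {l : List (Obs S A T)}
    (h : ¬ alg.halt l) (n : ℕ) : alg.expectedTotal M s₁ g q (n + 1) l =
      g l + expect (M.episodeLaw T (alg.sampling l) s₁) fun e =>
        alg.expectedTotal M s₁ g q n (l ++ [M.observe e]) := by
  simp [expectedTotal, h]

lemma expectedTotal_sum {ι : Type*} (s : Finset ι) (c : ι → ℝ≥0∞)
    (g : ι → List (Obs S A T) → ℝ≥0∞) (n : ℕ) (l : List (Obs S A T)) :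
    alg.expectedTotal M s₁ (fun l => ∑ i ∈ s, c i * g i l) 0 n l =
      ∑ i ∈ s, c i * alg.expectedTotal M s₁ (g i) 0 n l := by
  induction n generalizing l with
  | zero => by_cases h : alg.halt l <;> simp [expectedTotal, h]
  | succ n ih =>
    by_cases h : alg.halt l
    · simp [expectedTotal_of_halt h]
    · simp only [expectedTotal_succ h, ih, expect_sum, expect_const_mul, mul_add,
        Finset.sum_add_distrib]

variable (alg M s₁) in
open Classical in
/-- The probability, given the observations `l`, that the algorithm stops within `n` further
episodes and outputs a policy in `D`. -/
def successProb (D : Set (Policy S A T)) : ℕ → List (Obs S A T) → ℝ≥0∞ :=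
  alg.expectedTotal M s₁ 0 fun l => if alg.decision l ∈ D then 1 else 0

lemma successProb_mono (D : Set (Policy S A T)) (n : ℕ) (l : List (Obs S A T)) :
    alg.successProb M s₁ D n l ≤ alg.successProb M s₁ D (n + 1) l := by
  induction n generalizing l with
  | zero => by_cases h : alg.halt l <;> simp [successProb, expectedTotal, h]
  | succ n ih =>
    by_cases h : alg.halt l
    · simp [successProb, expectedTotal_of_halt h]
    · unfold successProb
      rw [expectedTotal_succ h, expectedTotal_succ h]
      gcongr
      exact expect_mono _ fun e => ih _

lemma successProb_add_le_one {D D' : Set (Policy S A T)} (hD : Disjoint D D') (n : ℕ)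
    (l : List (Obs S A T)) :
    alg.successProb M s₁ D n l + alg.successProb M s₁ D' n l ≤ 1 := by
  induction n generalizing l with
  | zero =>
    by_cases h : alg.halt l
    · simp only [successProb, expectedTotal_of_halt h]
      by_cases h1 : alg.decision l ∈ D
      · simp [h1, hD.notMem_of_mem_left h1]
      · split_ifs <;> simp
    · simp [successProb, expectedTotal_zero h]
  | succ n ih =>
    by_cases h : alg.halt l
    · simpa only [successProb, expectedTotal_of_halt h] using ih l
    · simp only [successProb, expectedTotal_succ h, Pi.zero_apply, zero_add, ← expect_add]
      exact (expect_mono _ fun e => ih _).trans (expect_const _ _).le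

lemma successProb_le_one (D : Set (Policy S A T)) (n : ℕ) (l : List (Obs S A T)) :
    alg.successProb M s₁ D n l ≤ 1 :=
  le_self_add.trans (successProb_add_le_one (disjoint_bot_right (a := D)) n l)

/-- Change of measure for the whole interaction, stopped after `n` episodes: the divergence between
`M` and `M'` that is collected under `M` bounds how differently the algorithm behaves in the two
tasks. The test function is `1 + b · 1_E`, for the event `E` that the output lies in `D`. -/
lemma elog_mul_successProb_le [Fintype S] [Fintype A] [MeasurableSpace S]
    [DiscreteMeasurableSpace S] [MeasurableSpace A] [DiscreteMeasurableSpace A] (M' : MDP S A)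
    (D : Set (Policy S A T)) {b : ℝ≥0∞} (hb : b ≠ ∞) (n : ℕ) (l : List (Obs S A T)) :
    elog (1 + b) * alg.successProb M s₁ D n l ≤
      alg.expectedTotal M s₁ (fun l => ∑ t, expect (M.stepLaw T (alg.sampling l) s₁ t)
        fun x => divergence M M' x.1 x.2) 0 n l +
      elog (1 + b * alg.successProb M' s₁ D n l) := by
  induction n generalizing l with
  | zero =>
    by_cases h : alg.halt l <;> by_cases hD : alg.decision l ∈ D <;>
      simp [successProb, expectedTotal, h, hD]
  | succ n ih =>
    by_cases h : alg.halt l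
    · by_cases hD : alg.decision l ∈ D <;> simp [successProb, expectedTotal_of_halt h, hD]
    have hep := expect_elog_episode_le M M' (alg.sampling l) s₁
      (Z := fun o => 1 + b * alg.successProb M' s₁ D n (l ++ [o])) (fun o => le_self_add)
      (fun o => by
        have := ne_top_of_le_ne_top ENNReal.one_ne_top (successProb_le_one (alg := alg) (M := M')
          (s₁ := s₁) D n (l ++ [o]))
        finiteness)
    have hs : ∀ M : MDP S A, alg.successProb M s₁ D (n + 1) l =
        expect (M.episodeLaw T (alg.sampling l) s₁) fun e =>
          alg.successProb M s₁ D n (l ++ [M.observe e]) := fun M => by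
      simp [successProb, expectedTotal_succ h]
    rw [hs, hs, expectedTotal_succ h, ← expect_const_mul]
    refine (expect_mono _ fun e => ih _).trans ?_
    rw [expect_add]
    simp only [expect_add, expect_const, expect_const_mul] at hep ⊢
    calc _ ≤ _ := add_le_add_right hep _
      _ = _ := by ring

/-! ### The law of the sequence of episodes -/

variable (alg M) in
open Classical in
/-- The total of the running reward `g` and the terminal reward `q` along the sequence `e` of
episodes, from episode `k` on, over at most `n` episodes. -/
def pathTotal (g q : List (Obs S A T) → ℝ≥0∞) (e : ℕ → Episode S A T) : ℕ → ℕ → ℝ≥0∞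
  | 0, k => if alg.halt (pastObs M e k) then q (pastObs M e k) else 0
  | n + 1, k => if alg.halt (pastObs M e k) then q (pastObs M e k) else
      g (pastObs M e k) + pathTotal g q e n (k + 1)

lemma pastObs_zero (e : ℕ → Episode S A T) : pastObs M e 0 = [] := by
  simp [pastObs, MDP.history]

lemma pastObs_succ (e : ℕ → Episode S A T) (k : ℕ) :
    pastObs M e (k + 1) = pastObs M e k ++ [M.observe (e k)] := by
  simp only [pastObs, MDP.history]
  rw [List.ofFn_succ', List.concat_eq_append]
  rfl

/-- The number of episodes in `pathTotal` is at most the number of episodes until the algorithm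
stops. -/
lemma pathTotal_one_add_le {e : ℕ → Episode S A T} {h : ℕ} (hh : alg.halt (pastObs M e h))
    (n k : ℕ) (hk : k ≤ h) : alg.pathTotal M 1 0 e n k + k ≤ h := by
  by_cases hhk : alg.halt (pastObs M e k)
  · cases n <;> simpa [pathTotal, hhk]
  induction n generalizing k with
  | zero => simpa [pathTotal]
  | succ n ih =>
    have hlt : k < h := lt_of_le_of_ne hk fun h' => hhk (h' ▸ hh)
    have : alg.pathTotal M 1 0 e n (k + 1) + ((k + 1 : ℕ) : ℝ≥0∞) ≤ h := by
      by_cases hhk' : alg.halt (pastObs M e (k + 1))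
      · have h2 : ((k + 1 : ℕ) : ℝ≥0∞) ≤ h := by exact_mod_cast hlt
        cases n <;> simpa [pathTotal, hhk'] using h2
      · exact ih _ hlt hhk'
    simp only [pathTotal, hhk, if_false, Pi.one_apply]
    convert this using 1
    push_cast
    ring

lemma pathTotal_eq_of_stopsAt {q : List (Obs S A T) → ℝ≥0∞} {e : ℕ → Episode S A T} {h : ℕ}
    (hh : alg.StopsAt M e h) (n k : ℕ) (hk : k ≤ h) (hn : h ≤ k + n) :
    alg.pathTotal M 0 q e n k = q (pastObs M e h) := by
  induction n generalizing k with
  | zero =>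
    obtain rfl : k = h := by omega
    simp [pathTotal, hh.1]
  | succ n ih =>
    rcases hk.eq_or_lt with rfl | hlt
    · simp [pathTotal, hh.1]
    · simpa [pathTotal, hh.2 k hlt] using ih (k + 1) hlt (by omega)

lemma mul_pathTotal_one_le_samples (e : ℕ → Episode S A T) (n : ℕ) :
    (T : ℝ≥0∞) * alg.pathTotal M 1 0 e n 0 ≤ (alg.samples M e : ℝ≥0∞) := by
  simp only [samples, ENat.toENNReal_iInf, le_iInf_iff]
  intro h hh
  have := pathTotal_one_add_le hh.1 n 0 h.zero_le
  simp only [Nat.cast_zero, add_zero] at this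
  push_cast
  gcongr

section law

variable [Fintype S] [Fintype A] [MeasurableSpace S] [DiscreteMeasurableSpace S]
  [MeasurableSpace A] [DiscreteMeasurableSpace A]

instance : IsProbabilityMeasure (alg.law M s₁) := by
  unfold law
  infer_instance

lemma measurable_comp_pastObs (k : ℕ) (f : List (Obs S A T) → ℝ≥0∞) :
    Measurable fun e : ℕ → Episode S A T => f (pastObs M e k) := by
  have : Measurable fun e : Fin k → Episode S A T => f (M.history e) := .of_discrete
  exact this.comp (measurable_pi_lambda (fun (e : ℕ → Episode S A T) (j : Fin k) => e j)
    fun j => measurable_pi_apply _)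

lemma measurable_pathTotal (g q : List (Obs S A T) → ℝ≥0∞) (n k : ℕ) :
    Measurable fun e : ℕ → Episode S A T => alg.pathTotal M g q e n k := by
  classical
  induction n generalizing k with
  | zero => exact measurable_comp_pastObs k fun l => if alg.halt l then q l else 0
  | succ n ih =>
    have : (fun e : ℕ → Episode S A T => alg.pathTotal M g q e (n + 1) k) = fun e =>
        (if alg.halt (pastObs M e k) then q (pastObs M e k) else g (pastObs M e k)) +
          (if alg.halt (pastObs M e k) then 0 else 1) * alg.pathTotal M g q e n (k + 1) := by
      funext e
      by_cases h : alg.halt (pastObs M e k) <;> simp [pathTotal, h]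
    rw [this]
    exact (measurable_comp_pastObs k fun l => if alg.halt l then q l else g l).add
      ((measurable_comp_pastObs k fun l => if alg.halt l then 0 else 1).mul (ih _))

/-- The tower property: given the first `k` episodes, the next one follows the policy that the
sampling rule selects. -/
lemma lintegral_next (k : ℕ) (F : List (Obs S A T) → Episode S A T → ℝ≥0∞) :
    ∫⁻ e, F (pastObs M e k) (e k) ∂(alg.law M s₁) =
      ∫⁻ e, expect (M.episodeLaw T (alg.sampling (pastObs M e k)) s₁) (F (pastObs M e k))
        ∂(alg.law M s₁) := by
  cases k with
  | zero =>
    simp only [pastObs_zero, lintegral_const, measure_univ, mul_one]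
    have : (alg.law M s₁).map (fun e => e 0) = (M.episodeLaw T (alg.sampling []) s₁).toMeasure := by
      have h0 : (alg.law M s₁).map (Preorder.frestrictLe 0) =
          (M.episodeLaw T (alg.sampling []) s₁).toMeasure.map
            (MeasurableEquiv.piUnique fun _ : Finset.Iic 0 => Episode S A T).symm := by
        unfold law Kernel.trajMeasure
        rw [Measure.map_comp _ _ (by fun_prop), Kernel.traj_map_frestrictLe,
          Kernel.partialTraj_self, Measure.id_comp]
      have h1 : (fun e : ℕ → Episode S A T => e 0) =
          (MeasurableEquiv.piUnique fun _ : Finset.Iic 0 => Episode S A T) ∘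
            Preorder.frestrictLe 0 := rfl
      rw [h1, ← Measure.map_map (by fun_prop) (by fun_prop), h0,
        MeasurableEquiv.map_map_symm]
    rw [← lintegral_toMeasure_eq_expect, ← this, lintegral_map .of_discrete (by fun_prop)]
  | succ k =>
    have hmap := Kernel.map_frestrictLe_trajMeasure_compProd_eq_map_trajMeasure
      (X := fun _ => Episode S A T) (μ₀ := (M.episodeLaw T (alg.sampling []) s₁).toMeasure)
      (κ := alg.nextEpisode M s₁) (a := k)
    let G : (Π _ : Finset.Iic k, Episode S A T) → Episode S A T → ℝ≥0∞ := fun e =>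
      F (M.history (h := k + 1) fun j =>
        e ⟨j.val, Finset.mem_Iic.mpr (Nat.lt_succ_iff.mp j.isLt)⟩)
    have hG : Measurable (Function.uncurry G) :=
      measurable_from_prod_countable_right fun _ => .of_discrete
    calc ∫⁻ e, F (pastObs M e (k + 1)) (e (k + 1)) ∂(alg.law M s₁)
        = ∫⁻ x, Function.uncurry G x
            ∂((alg.law M s₁).map fun e => (Preorder.frestrictLe k e, e (k + 1))) := by
          rw [lintegral_map hG (by fun_prop)]
          rfl
      _ = ∫⁻ e, ∫⁻ x, G (Preorder.frestrictLe k e) x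
            ∂(alg.nextEpisode M s₁ k (Preorder.frestrictLe k e)) ∂(alg.law M s₁) := by
          unfold law
          rw [← hmap, Measure.lintegral_compProd hG, lintegral_map .of_discrete (by fun_prop)]
          rfl
      _ = _ := by
          refine lintegral_congr fun e => ?_
          exact lintegral_toMeasure_eq_expect _ _

lemma lintegral_mul_pathTotal (g q w : List (Obs S A T) → ℝ≥0∞) (n k : ℕ) :
    ∫⁻ e, w (pastObs M e k) * alg.pathTotal M g q e n k ∂(alg.law M s₁) =
      ∫⁻ e, w (pastObs M e k) * alg.expectedTotal M s₁ g q n (pastObs M e k)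
        ∂(alg.law M s₁) := by
  classical
  induction n generalizing k w with
  | zero => rfl
  | succ n ih =>
    -- the weight of the histories on which episode `k` is run
    let v : List (Obs S A T) → ℝ≥0∞ := fun l => if alg.halt l then 0 else w l
    let u : List (Obs S A T) → ℝ≥0∞ := fun l => w l * (if alg.halt l then q l else g l)
    have hv := ih (fun l => v l.dropLast) (k + 1)
    simp only [pastObs_succ, List.dropLast_concat] at hv
    have hnext := lintegral_next (alg := alg) (M := M) (s₁ := s₁) k fun l e =>
      v l * alg.expectedTotal M s₁ g q n (l ++ [M.observe e])
    simp only [expect_const_mul] at hnext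
    have h1 : ∀ e, w (pastObs M e k) * alg.pathTotal M g q e (n + 1) k =
        u (pastObs M e k) + v (pastObs M e k) * alg.pathTotal M g q e n (k + 1) := by
      intro e
      by_cases h : alg.halt (pastObs M e k) <;> simp [pathTotal, u, v, h, mul_add]
    have h2 : ∀ l, w l * alg.expectedTotal M s₁ g q (n + 1) l = u l + v l *
        expect (M.episodeLaw T (alg.sampling l) s₁) fun e =>
          alg.expectedTotal M s₁ g q n (l ++ [M.observe e]) := by
      intro l
      by_cases h : alg.halt l
      · simp [expectedTotal_of_halt, u, v, h]
      · simp [expectedTotal_succ, u, v, h, mul_add]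
    simp only [h1, h2]
    rw [lintegral_add_left (measurable_comp_pastObs k u),
      lintegral_add_left (measurable_comp_pastObs k u), hv, hnext]

/-- The recursion `expectedTotal` computes the expectation of the path functional `pathTotal`. -/
lemma lintegral_pathTotal (g q : List (Obs S A T) → ℝ≥0∞) (n : ℕ) :
    ∫⁻ e, alg.pathTotal M g q e n 0 ∂(alg.law M s₁) = alg.expectedTotal M s₁ g q n [] := by
  have := lintegral_mul_pathTotal (alg := alg) (M := M) (s₁ := s₁) g q 1 n 0
  simpa [pastObs_zero] using this

lemma mul_expectedTotal_one_le_sampleComplexity (n : ℕ) :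
    (T : ℝ≥0∞) * alg.expectedTotal M s₁ 1 0 n [] ≤ alg.sampleComplexity M s₁ := by
  rw [← lintegral_pathTotal, ← lintegral_const_mul _ (measurable_pathTotal _ _ _ _)]
  exact lintegral_mono fun e => mul_pathTotal_one_le_samples e n

lemma measure_success_le_iSup (D : Set (Policy S A T)) :
    alg.law M s₁ {e | ∃ h, alg.StopsAt M e h ∧ alg.decision (pastObs M e h) ∈ D} ≤
      ⨆ n, alg.successProb M s₁ D n [] := by
  classical
  have hU : {e | ∃ h, alg.StopsAt M e h ∧ alg.decision (pastObs M e h) ∈ D} =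
      ⋃ n : ℕ, {e | ∃ h ≤ n, alg.StopsAt M e h ∧ alg.decision (pastObs M e h) ∈ D} := by
    ext e
    simp only [Set.mem_ofPred_eq, Set.mem_iUnion]
    exact ⟨fun ⟨h, hh⟩ => ⟨h, h, le_rfl, hh⟩, fun ⟨_, h, _, hh⟩ => ⟨h, hh⟩⟩
  have hmono : Monotone fun n : ℕ =>
      {e | ∃ h ≤ n, alg.StopsAt M e h ∧ alg.decision (pastObs M e h) ∈ D} :=
    fun m n hmn e ⟨h, hm, hh⟩ => ⟨h, hm.trans hmn, hh⟩
  rw [hU, hmono.measure_iUnion]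
  refine iSup_mono fun n => ?_
  rw [successProb, ← lintegral_pathTotal]
  refine (measure_mono ?_).trans ((mul_meas_ge_le_lintegral (measurable_pathTotal _ _ n 0) 1).trans'
    (one_mul _).ge)
  rintro e ⟨h, hn, hh, hD⟩
  simp [pathTotal_eq_of_stopsAt hh n 0 h.zero_le (by omega), hD]

end law

end Algorithm

/-! ### Allocations and the sample complexity -/

namespace Algorithm

variable {T : ℕ} {alg : Algorithm S A T} {M : MDP S A} {s₁ : S}

lemma successProb_add_measure_success_le_one [Fintype S] [Fintype A] [MeasurableSpace S]
    [DiscreteMeasurableSpace S] [MeasurableSpace A] [DiscreteMeasurableSpace A]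
    {D D' : Set (Policy S A T)} (hD : Disjoint D D') (n : ℕ) :
    alg.successProb M s₁ D n [] + alg.law M s₁
      {e | ∃ h, alg.StopsAt M e h ∧ alg.decision (pastObs M e h) ∈ D'} ≤ 1 := by
  have hmono : ∀ D : Set (Policy S A T), Monotone fun n => alg.successProb M s₁ D n [] :=
    fun D => monotone_nat_of_le_succ fun n => successProb_mono D n []
  calc _ ≤ alg.successProb M s₁ D n [] + ⨆ m, alg.successProb M s₁ D' m [] := by
        gcongr
        exact measure_success_le_iSup D'
    _ ≤ 1 := by
        rw [ENNReal.add_iSup]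
        refine iSup_le fun m => ?_
        exact (add_le_add (hmono D (le_max_left n m)) (hmono D' (le_max_right n m))).trans
          (successProb_add_le_one hD _ [])

lemma expectedTotal_one_le (n : ℕ) (l : List (Obs S A T)) :
    alg.expectedTotal M s₁ 1 0 n l ≤ n := by
  induction n generalizing l with
  | zero => by_cases h : alg.halt l <;> simp [expectedTotal, h]
  | succ n ih =>
    by_cases h : alg.halt l
    · simp [expectedTotal_of_halt h]
    · rw [expectedTotal_succ h, Nat.cast_add, Nat.cast_one, add_comm]
      gcongr
      · exact (expect_mono _ fun e => ih _).trans (expect_const _ _).le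
      · rfl

lemma expectedTotal_eq_zero_of_one (g : List (Obs S A T) → ℝ≥0∞) {n : ℕ} {l : List (Obs S A T)}
    (h0 : alg.expectedTotal M s₁ 1 0 n l = 0) : alg.expectedTotal M s₁ g 0 n l = 0 := by
  by_cases h : alg.halt l
  · simp [expectedTotal_of_halt h]
  · cases n with
    | zero => exact expectedTotal_zero h
    | succ n => simp [expectedTotal_succ h] at h0

section allocation

variable [Fintype S] [Fintype A]

lemma sum_expectedTotal_stepLaw_mul (t : Fin T) (f : S × A → ℝ≥0∞) (n : ℕ)
    (l : List (Obs S A T)) :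
    ∑ x, alg.expectedTotal M s₁ (fun l => M.stepLaw T (alg.sampling l) s₁ t x) 0 n l * f x =
      alg.expectedTotal M s₁ (fun l => expect (M.stepLaw T (alg.sampling l) s₁ t) f) 0 n l := by
  simp only [mul_comm _ (f _), ← expectedTotal_sum, expect, tsum_fintype]

/-- The expected visit counts up to the stopping time, capped at `n` episodes, are an allocation
of the task, up to the factor `T` times the expected number of episodes. -/
lemma exists_allocation (hT : 1 ≤ T) (n : ℕ) (l : List (Obs S A T))
    (hU : alg.expectedTotal M s₁ 1 0 n l ≠ 0) :
    ∃ ω ∈ M.allocations s₁ T, ∀ f : S × A → ℝ≥0∞,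
      T * alg.expectedTotal M s₁ 1 0 n l * ∑ x, ω x * f x =
        alg.expectedTotal M s₁
          (fun l => ∑ t, expect (M.stepLaw T (alg.sampling l) s₁ t) f) 0 n l := by
  classical
  set U := alg.expectedTotal M s₁ 1 0 n l with hUdef
  set W : Fin T → S × A → ℝ≥0∞ := fun t x =>
    alg.expectedTotal M s₁ (fun l => M.stepLaw T (alg.sampling l) s₁ t x) 0 n l with hW
  have hUt : U ≠ ∞ := ne_top_of_le_ne_top (ENNReal.natCast_ne_top n) (expectedTotal_one_le n l)
  have hT0 : (T : ℝ≥0∞) ≠ 0 := by exact_mod_cast (by omega : T ≠ 0)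
  have hWf : ∀ t f, ∑ x, W t x * f x = alg.expectedTotal M s₁
      (fun l => expect (M.stepLaw T (alg.sampling l) s₁ t) f) 0 n l := fun t f =>
    sum_expectedTotal_stepLaw_mul t f n l
  have hwf : ∀ t f, ∑ x, U⁻¹ * W t x * f x = U⁻¹ * alg.expectedTotal M s₁
      (fun l => expect (M.stepLaw T (alg.sampling l) s₁ t) f) 0 n l := fun t f => by
    simp only [← hWf, Finset.mul_sum, mul_assoc]
  have hw1 : ∀ t, ∑ x, U⁻¹ * W t x = 1 := fun t => by
    have := hwf t 1
    simp only [Pi.one_apply, mul_one, Pi.one_def, expect_const] at this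
    rw [this]
    exact ENNReal.inv_mul_cancel hU hUt
  have hω1 : ∑ x, (T : ℝ≥0∞)⁻¹ * ∑ t, U⁻¹ * W t x = 1 := by
    rw [← Finset.mul_sum, Finset.sum_comm]
    simp only [hw1, Finset.sum_const, Finset.card_univ, Fintype.card_fin, nsmul_eq_mul, mul_one]
    exact ENNReal.inv_mul_cancel hT0 (ENNReal.natCast_ne_top T)
  -- the mass of a state is the expectation of an indicator function of the state
  have hmarg : ∀ t s, ∑ a, U⁻¹ * W t (s, a) = U⁻¹ * alg.expectedTotal M s₁
      (fun l => expect (M.stepLaw T (alg.sampling l) s₁ t)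
        fun x => if x.1 = s then 1 else 0) 0 n l := fun t s => by
    rw [← hwf, Fintype.sum_prod_type, Finset.sum_eq_single s]
    · simp
    · intro s' _ hs'
      simp [hs']
    · simp
  refine ⟨PMF.ofFintype _ hω1, ⟨fun t => PMF.ofFintype _ (hw1 t), fun x => rfl, ?_, ?_⟩, ?_⟩
  · intro t ht
    simp only [PMF.ofFintype_apply]
    rw [hmarg]
    simp only [MDP.expect_stepLaw_initial M _ s₁ t ht fun s => if s = s₁ then 1 else 0, if_true]
    exact ENNReal.inv_mul_cancel hU hUt
  · intro t t' htt' s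
    simp only [PMF.ofFintype_apply]
    rw [hmarg]
    simp only [MDP.expect_stepLaw_flow M _ s₁ t t' htt' fun s' => if s' = s then 1 else 0]
    rw [← hwf, Fintype.sum_prod_type]
    refine Finset.sum_congr rfl fun s' _ => Finset.sum_congr rfl fun a' _ => ?_
    simp [expect, mul_comm]
  · intro f
    have := expectedTotal_sum (alg := alg) (M := M) (s₁ := s₁) Finset.univ (fun _ => 1)
      (fun t l => expect (M.stepLaw T (alg.sampling l) s₁ t) f) n l
    simp only [one_mul] at this
    rw [this]
    simp only [← hWf, PMF.ofFintype_apply]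
    rw [Finset.sum_comm, Finset.mul_sum]
    refine Finset.sum_congr rfl fun x _ => ?_
    rw [← Finset.sum_mul, ← Finset.mul_sum]
    calc _ = (T * (T : ℝ≥0∞)⁻¹) * (U * U⁻¹) * ((∑ t, W t x) * f x) := by ring
      _ = _ := by
        rw [ENNReal.mul_inv_cancel hT0 (ENNReal.natCast_ne_top T),
          ENNReal.mul_inv_cancel hU hUt, one_mul, one_mul]

end allocation

end Algorithm

variable [Fintype S] [Fintype A]

/-- Every policy induces an allocation. This is the case of `Algorithm.exists_allocation` in which
the policy is run for a single episode. -/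
lemma MDP.allocations_nonempty (M : MDP S A) (s₁ : S) {T : ℕ} (hT : 1 ≤ T) (π : Policy S A T) :
    (M.allocations s₁ T).Nonempty := by
  let alg : Algorithm S A T := ⟨fun _ => π, fun _ => False, fun _ => π⟩
  obtain ⟨ω, hω, -⟩ := Algorithm.exists_allocation (alg := alg) (M := M) (s₁ := s₁) hT 1 []
    (by rw [Algorithm.expectedTotal_succ (by simp [alg])]; simp)
  exact ⟨ω, hω⟩

variable {ι : Type*}

lemma Tstar_eq_top_of_alternatives_eq_empty [MeasurableSpace S] {M : ι → MDP S A} {s₁ : S} {T : ℕ}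
    (hT : 1 ≤ T) (π : Policy S A T) {i : ι} (h : alternatives M s₁ T i = ∅) :
    Tstar M s₁ T i = ∞ := by
  obtain ⟨ω, hω⟩ := (M i).allocations_nonempty s₁ hT π
  refine top_le_iff.mp (le_iSup₂_of_le ω hω ?_)
  simp [h]

/-- If the output lies in `D` with probability at most `ε` in every alternative, then the
information that is needed to output a policy in `D` in the task `i` costs samples at a rate of at
most `Tstar`. -/
lemma Algorithm.elog_mul_successProb_le_sampleComplexity [MeasurableSpace S]
    [DiscreteMeasurableSpace S] [MeasurableSpace A] [DiscreteMeasurableSpace A] {T : ℕ}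
    (alg : Algorithm S A T) (M : ι → MDP S A) (s₁ : S) (hT : 1 ≤ T) (i : ι)
    (D : Set (Policy S A T)) {b ε : ℝ≥0∞} (hb : b ≠ ∞) (hε : ε ≠ ∞)
    (hne : (alternatives M s₁ T i).Nonempty) (n : ℕ)
    (hD : ∀ j ∈ alternatives M s₁ T i, alg.successProb (M j) s₁ D n [] ≤ ε) :
    elog (1 + b) * alg.successProb (M i) s₁ D n [] ≤
      alg.sampleComplexity (M i) s₁ * Tstar M s₁ T i + elog (1 + b * ε) := by
  set U := alg.expectedTotal (M i) s₁ 1 0 n [] with hUdef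
  have hj : ∀ j ∈ alternatives M s₁ T i, elog (1 + b) * alg.successProb (M i) s₁ D n [] ≤
      alg.expectedTotal (M i) s₁ (fun l => ∑ t, expect ((M i).stepLaw T (alg.sampling l) s₁ t)
        fun x => divergence (M i) (M j) x.1 x.2) 0 n [] + elog (1 + b * ε) := fun j hj => by
    refine (elog_mul_successProb_le (M j) D hb n []).trans ?_
    gcongr
    refine elog_mono le_self_add ?_ (by finiteness)
    gcongr
    exact hD j hj
  by_cases hU : U = 0
  · obtain ⟨j, hj'⟩ := hne
    refine (hj j hj').trans ?_
    rw [expectedTotal_eq_zero_of_one _ hU, zero_add]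
    exact le_add_self
  obtain ⟨ω, hω, hωf⟩ := exists_allocation hT n [] hU
  have hT0 : (T : ℝ≥0∞) ≠ 0 := by exact_mod_cast (by omega : T ≠ 0)
  have hUt : U ≠ ∞ := ne_top_of_le_ne_top (ENNReal.natCast_ne_top n) (expectedTotal_one_le n [])
  have hle : (elog (1 + b) * alg.successProb (M i) s₁ D n [] - elog (1 + b * ε)) / (T * U) ≤
      Tstar M s₁ T i := by
    refine le_iSup₂_of_le ω hω (le_iInf₂ fun j hj' => ?_)
    refine ENNReal.div_le_of_le_mul' (tsub_le_iff_right.mpr ((hj j hj').trans_eq ?_))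
    rw [← hωf, Fintype.sum_prod_type]
  rw [ENNReal.div_le_iff (mul_ne_zero hT0 hU) (ENNReal.mul_ne_top (ENNReal.natCast_ne_top T) hUt)]
    at hle
  refine (tsub_le_iff_right.mp hle).trans ?_
  rw [mul_comm]
  gcongr
  exact mul_expectedTotal_one_le_sampleComplexity n

/-! ### A lower bound for the binary divergence -/

/-- `kl(1 - δ, δ) = (1 - 2δ) log((1 - δ)/δ)` is at least `log(1/(2.4δ))`. The difference of the two
sides is a convex function of `δ`, and its tangent at `δ = 8/25`, near the minimum, is
nonnegative on `(0, 1/2)`. -/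
lemma log_inv_le_binary_kl {δ : ℝ} (h0 : 0 < δ) (h1 : δ < 1 / 2) :
    Real.log (1 / (2.4 * δ)) ≤ (1 - 2 * δ) * Real.log ((1 - δ) / δ) := by
  have h2 : 0 < 1 - δ := by linarith
  have hab : 8 / 17 ≤ Real.log (17 / 25) + Real.log 2.4 := by
    rw [← Real.log_mul (by norm_num) (by norm_num), Real.le_log_iff_exp_le (by norm_num)]
    refine le_of_pow_le_pow_left₀ (n := 17) (by norm_num) (by positivity) ?_
    rw [← Real.exp_nat_mul, show ((17 : ℕ) : ℝ) * (8 / 17) = (8 : ℕ) * 1 by norm_num,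
      Real.exp_nat_mul]
    exact (pow_le_pow_left₀ (Real.exp_pos 1).le Real.exp_one_lt_d9.le 8).trans (by norm_num)
  have hbb : -(9 / 34) ≤ Real.log (8 / 25) + Real.log 2.4 := by
    rw [← Real.log_mul (by norm_num) (by norm_num), Real.le_log_iff_exp_le (by norm_num),
      Real.exp_neg]
    refine inv_le_of_inv_le₀ (by norm_num) ?_
    refine le_of_pow_le_pow_left₀ (n := 34) (by norm_num) (by positivity) ?_
    rw [← Real.exp_nat_mul, show ((34 : ℕ) : ℝ) * (9 / 34) = (9 : ℕ) * 1 by norm_num,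
      Real.exp_nat_mul]
    exact (pow_le_pow_left₀ (by norm_num) Real.exp_one_gt_d9.le 9).trans' (by norm_num)
  -- tangent line bounds for the logarithm at `8/25` and at `17/25`
  have tangent : ∀ c x : ℝ, 0 < c → 0 < x → Real.log c + 1 - c / x ≤ Real.log x := by
    intro c x hc hx
    have := Real.log_le_sub_one_of_pos (div_pos hc hx)
    rw [Real.log_div hc.ne' hx.ne'] at this
    linarith
  have t1 := mul_le_mul_of_nonneg_left (tangent (8 / 25) δ (by norm_num) h0) h0.le
  have t2 := mul_le_mul_of_nonneg_left (tangent (17 / 25) (1 - δ) (by norm_num) h2)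
    (show 0 ≤ 1 - 2 * δ by linarith)
  have e1 : δ * (8 / 25 / δ) = 8 / 25 := by field_simp
  have e2 : (1 - 2 * δ) * (17 / 25 / (1 - δ)) ≤
      17 / 25 * (2 - 25 / 17 - (δ - 8 / 25) * (25 / 17) ^ 2) := by
    rw [← mul_div_assoc, div_le_iff₀ h2]
    nlinarith [sq_nonneg (δ - 8 / 25)]
  have m1 := mul_le_mul_of_nonneg_left hab (show 0 ≤ 1 - 2 * δ by linarith)
  have m2 := mul_le_mul_of_nonneg_left hbb (show 0 ≤ 2 * δ by linarith)
  rw [one_div, Real.log_inv, Real.log_mul (by norm_num) h0.ne', Real.log_div h2.ne' h0.ne']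
  nlinarith

end BPI

end

theorem mainTheorem5 {S A ι : Type*} [Fintype S] [Fintype A] [Finite ι]
    [MeasurableSpace S] [DiscreteMeasurableSpace S]
    [MeasurableSpace A] [DiscreteMeasurableSpace A]
    (T : ℕ) (hT : 1 ≤ T) (s₁ : S) (M : ι → BPI.MDP S A)
    (δ : ℝ) (hδ : δ ∈ Set.Ioo (0 : ℝ) 1)
    (alg : BPI.Algorithm S A T) (hPC : alg.IsPC M s₁ δ) (i : ι) :
    (BPI.Tstar M s₁ T i)⁻¹ * ENNReal.ofReal (Real.log (1 / (2.4 * δ))) ≤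
      alg.sampleComplexity (M i) s₁ := by
  obtain ⟨hδ0, hδ1⟩ := hδ
  rcases (BPI.alternatives M s₁ T i).eq_empty_or_nonempty with hemp | hne
  · simp [BPI.Tstar_eq_top_of_alternatives_eq_empty hT (alg.sampling []) hemp]
  rw [mul_comm, ← div_eq_mul_inv]
  refine ENNReal.div_le_of_le_mul ?_
  rcases le_or_gt (1 / 2) δ with hlarge | hsmall
  · rw [ENNReal.ofReal_of_nonpos]
    · exact zero_le
    · refine Real.log_nonpos (by positivity) ?_
      rw [div_le_one (by positivity)]
      linarith
  set D := (M i).optimalPolicies s₁ T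
  -- the choice of `b` that makes the change of measure sharp for the probabilities `1 - δ` and `δ`
  set r : ℝ := (1 - δ) / δ with hr
  have hr1 : 1 ≤ r := by
    rw [hr, le_div_iff₀ hδ0]
    linarith
  set b : ℝ≥0∞ := ENNReal.ofReal (r ^ 2 - 1) with hb
  have hr2 : 0 ≤ r ^ 2 - 1 := by nlinarith
  have hsplit : (1 : ℝ≥0∞) = ENNReal.ofReal δ + ENNReal.ofReal (1 - δ) := by
    rw [← ENNReal.ofReal_add hδ0.le (by linarith)]
    simp
  have hlog : BPI.elog (1 + b) = ENNReal.ofReal (2 * Real.log r) := by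
    rw [hb, ← ENNReal.ofReal_one, ← ENNReal.ofReal_add zero_le_one hr2, BPI.elog,
      ENNReal.toReal_ofReal (by linarith), add_sub_cancel, Real.log_pow, Nat.cast_ofNat]
  have hlog' : BPI.elog (1 + b * ENNReal.ofReal δ) = ENNReal.ofReal (Real.log r) := by
    rw [hb, ← ENNReal.ofReal_mul hr2, ← ENNReal.ofReal_one,
      ← ENNReal.ofReal_add zero_le_one (by positivity), BPI.elog,
      ENNReal.toReal_ofReal (by positivity)]
    congr 2
    rw [hr]
    field_simp
    ring
  have hwrong : ∀ n, ∀ j ∈ BPI.alternatives M s₁ T i,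
      alg.successProb (M j) s₁ D n [] ≤ ENNReal.ofReal δ := by
    intro n j hj
    have h := (add_le_add_right (hPC j) _).trans
      (BPI.Algorithm.successProb_add_measure_success_le_one (alg := alg) hj n)
    rw [hsplit] at h
    exact ENNReal.le_of_add_le_add_right ENNReal.ofReal_ne_top h
  have hbound : ENNReal.ofReal (2 * Real.log r) * ENNReal.ofReal (1 - δ) ≤
      alg.sampleComplexity (M i) s₁ * BPI.Tstar M s₁ T i + ENNReal.ofReal (Real.log r) := by
    refine (mul_le_mul_right ((hPC i).trans (BPI.Algorithm.measure_success_le_iSup D)) _).trans ?_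
    rw [ENNReal.mul_iSup]
    refine iSup_le fun n => ?_
    rw [← hlog, ← hlog']
    exact alg.elog_mul_successProb_le_sampleComplexity M s₁ hT i D ENNReal.ofReal_ne_top
      ENNReal.ofReal_ne_top hne n (hwrong n)
  refine ENNReal.le_of_add_le_add_right ENNReal.ofReal_ne_top (hbound.trans' ?_)
  have hr0 := Real.log_nonneg hr1
  have hkl := BPI.log_inv_le_binary_kl hδ0 hsmall
  calc _ ≤ ENNReal.ofReal ((1 - 2 * δ) * Real.log r) + ENNReal.ofReal (Real.log r) := by gcongr
    _ = _ := by
      rw [← ENNReal.ofReal_add (mul_nonneg (by linarith) hr0) hr0,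
        ← ENNReal.ofReal_mul (by positivity)]
      congr 1
      ring
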